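/- Let $n\ge 1$, let $\mu_\infty$ be the group of roots of unity in $\overline{\mathbb{Q}}$, and let $\zeta=(\zeta_1,\dots,\zeta_n)\in\mu_\infty^n$ be a point of order $m$ in the group $\mu_\infty^n$. For $\lambda\in\mathbb{Z}^n$ write $\zeta^\lambda=\zeta_1^{\lambda_1}\cdots\zeta_n^{\lambda_n}$. Let $$F(X)=\sum_{i=1}^N a_iX^{\alpha_i}\in\mathbb{Z}[X_1^{\pm1},\dots,X_n^{\pm1}],\qquad a_i\in\mathbb{Z},\ \alpha_i\in\mathbb{Z}^n,$$ be a Laurent polynomial. Suppose that 1. $F(\zeta)=0$; 2. no proper subsum of $F(\zeta)$ vanishes, i.e. $\sum_{i\in J}a_i\zeta^{\alpha_i}\neq 0$ for every nonempty proper subset $J$ of $\{1,\dots,N\}$; 3. the differences $\alpha_i-\alpha_j$ $(1\le i,j\le N)$ generate the group $\mathbb{Z}^n$. Then $m$ is squarefree and $\Psi(m)\le N$, where $\Psi(m):=2+\sum_{p\mid m}(p-2)$, the sum running over the prime numbers $p$ dividing $m$. -/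

import Mathlib

noncomputable section

/-- The field of algebraic numbers. -/
abbrev QBar : Type := AlgebraicClosure ℚ

/-- The group of all roots of unity in the field of algebraic numbers. -/
abbrev MuInf : Subgroup QBarˣ := CommGroup.torsion QBarˣ

/-- Laurent polynomials with integer coefficients in `n` variables: finite formal combinations of
the monomials `X ^ l = ∏ i, X i ^ l i`, for exponent vectors `l` with integer entries. -/
abbrev MvLaurent (n : ℕ) : Type := AddMonoidAlgebra ℤ (Fin n → ℤ)

/-- The value `z ^ l = ∏ i, z i ^ l i` of the monomial with exponent vector `l` at the point `z`
of the torus. -/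
def torusMonomial {n : ℕ} (z : Fin n → QBarˣ) (l : Fin n → ℤ) : QBar :=
  ((∏ i, z i ^ l i : QBarˣ) : QBar)

/-- The value `F(z)` of a Laurent polynomial at a point of the torus. -/
def MvLaurent.eval {n : ℕ} (z : Fin n → QBarˣ) (F : MvLaurent n) : QBar :=
  F.coeff.sum fun l a => (a : QBar) * torusMonomial z l

/-- No proper subsum of `∑ i, v i` vanishes; the proper subsums are those over the nonempty
proper subsets of the index set. -/
def NoProperSubsumVanishes {ι : Type*} [Fintype ι] (v : ι → QBar) : Prop :=
  ∀ J : Finset ι, J.Nonempty → J ≠ Finset.univ → ∑ i ∈ J, v i ≠ 0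

/-- `Ψ(m) = 2 + ∑_{p ∣ m} (p - 2)`, where `p` runs over the prime divisors of `m`. -/
def conwayJonesPsi (m : ℕ) : ℤ :=
  2 + ∑ p ∈ m.primeFactors, ((p : ℤ) - 2)

end

/-!
The minimality of the vanishing sum enters only through a matroid property of the values
`η i = ζ ^ α i`: the span of the family is not the direct sum of the spans of two complementary
subfamilies. The hypothesis on the differences says that the ratios of the `η i` generate `μ_m`.

Following Mann and Conway–Jones, write `m = p * m'` with `p` prime, let `ω` be a primitive `m`-th
root of unity and `ξ = ω ^ p`, and sort the `η i` into `p` classes according to `η i = t i * ρ ^ j`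
with `t i ∈ ℚ(ξ)`, where `ρ = ω` if `p ∣ m'` and `ρ = ω ^ m'` otherwise.

* If `p ∣ m'`, the first `p` powers of `ρ` are independent over `ℚ(ξ)`, so the span is the direct
  sum of the contributions of the classes. By connectedness there is only one class, whose ratios
  are `m'`-th roots of unity, a contradiction. Hence `m` is squarefree.
* If `p ∤ m'`, the only relation is `∑ j, ρ ^ j = 0`. Connectedness then forces the spans of the `p`
  classes of the `t i` to share a nonzero vector, which makes the dimension of the span of the `t i`
  smaller by at least `p - 2` than that of the `η i`. The family `t` is again connected, with ratios
  generating `μ_m'`, and induction on `m` gives `Ψ(m) ≤ dim (span η) + 1`.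

A vanishing sum with nonzero coefficients makes this dimension at most `N - 1`.
-/

open Module Submodule

section SpanConnected

/-- Connectedness of a family of vectors in the sense of linear matroids: the span of the family is
not the direct sum of the spans of two complementary nonempty subfamilies. It is the only trace of
the minimality of a vanishing sum that the argument keeps. -/
def SpanConnected (k : Type*) {ι V : Type*} [Semiring k] [AddCommMonoid V] [Module k V]
    (v : ι → V) : Prop :=
  ∀ J : Set ι, J.Nonempty → Jᶜ.Nonempty → ¬ Disjoint (span k (v '' J)) (span k (v '' Jᶜ))

theorem SpanConnected.of_injective {k ι V W : Type*} [Ring k] [AddCommGroup V] [Module k V]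
    [AddCommGroup W] [Module k W] {f : V →ₗ[k] W} (hf : Function.Injective f) {v : ι → V}
    (h : SpanConnected k fun i => f (v i)) : SpanConnected k v := fun J hJ hJ' hdisj => by
  refine h J hJ hJ' ?_
  simpa only [map_span, Set.image_image] using disjoint_map hf hdisj

variable {k ι V : Type*} [Field k] [AddCommGroup V] [Module k V] [Fintype ι] {a : ι → k} {v : ι → V}

theorem spanConnected_of_sum_smul_eq_zero (hzero : ∑ i, a i • v i = 0)
    (hmin : ∀ J : Finset ι, J.Nonempty → J ≠ Finset.univ → ∑ i ∈ J, a i • v i ≠ 0) :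
    SpanConnected k v := by
  classical
  intro J hJ hJ' hdisj
  lift J to Finset ι using J.toFinite
  rw [← Finset.coe_compl] at hJ' hdisj
  have hmem (S : Finset ι) : ∑ i ∈ S, a i • v i ∈ span k (v '' S) :=
    sum_mem fun i hi => smul_mem _ _ (subset_span (Set.mem_image_of_mem v hi))
  have hneg : ∑ i ∈ J, a i • v i = -∑ i ∈ Jᶜ, a i • v i := by
    rw [eq_neg_iff_add_eq_zero, Finset.sum_add_sum_compl, hzero]
  refine hmin J hJ ?_ (disjoint_def.1 hdisj _ (hmem J) (hneg ▸ neg_mem (hmem Jᶜ)))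
  rintro rfl
  simp at hJ'

theorem finrank_span_range_lt_card (hzero : ∑ i, a i • v i = 0) {i : ι} (hi : a i ≠ 0) :
    finrank k (span k (Set.range v)) < Fintype.card ι := by
  refine (finrank_range_le_card v).lt_of_ne fun h => hi ?_
  exact Fintype.linearIndependent_iff.1 (linearIndependent_iff_card_eq_finrank_span.2 h.symm)
    a hzero i

end SpanConnected

section Finrank

variable {k V κ : Type*} [Field k] [AddCommGroup V] [Module k V]

theorem finrank_sup_add_card_mul_finrank_le (W : κ → Submodule k V)
    [∀ j, FiniteDimensional k (W j)] {D : Submodule k V} {s : Finset κ} (hs : s.Nonempty)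
    (hD : ∀ j ∈ s, D ≤ W j) :
    finrank k ↥(s.sup W) + s.card * finrank k D ≤ ∑ j ∈ s, finrank k (W j) + finrank k D := by
  induction hs using Finset.Nonempty.cons_induction with
  | singleton j => rw [Finset.sup_singleton, Finset.sum_singleton, Finset.card_singleton, one_mul]
  | cons j s hj hs ih =>
    obtain ⟨i, hi⟩ := hs
    have hDs : D ≤ s.sup W :=
      (hD i (Finset.mem_cons_of_mem hi)).trans (Finset.le_sup hi)
    have : FiniteDimensional k ↥(s.sup W) := finiteDimensional_finset_sup s W
    have hinf : finrank k D ≤ finrank k ↥(W j ⊓ s.sup W) :=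
      finrank_mono (le_inf (hD j (Finset.mem_cons_self j s)) hDs)
    have hadd := finrank_sup_add_finrank_inf_eq (W j) (s.sup W)
    have hrec := ih fun i hi => hD i (Finset.mem_cons_of_mem hi)
    rw [Finset.sup_cons, Finset.sum_cons, Finset.card_cons, add_one_mul]
    omega

theorem finrank_iSup_add_card_mul_finrank_iInf_le [Fintype κ] [Nonempty κ]
    (W : κ → Submodule k V) [∀ j, FiniteDimensional k (W j)] :
    finrank k ↥(⨆ j, W j) + Fintype.card κ * finrank k ↥(⨅ j, W j) ≤
      ∑ j, finrank k (W j) + finrank k ↥(⨅ j, W j) := by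
  rw [← Finset.sup_univ_eq_iSup]
  exact finrank_sup_add_card_mul_finrank_le W Finset.univ_nonempty fun j _ => iInf_le W j

theorem finrank_map_pi_add_finrank_iInf {E : Type*} [AddCommGroup E] [Module k E] [Fintype κ]
    [Nonempty κ] {Φ : (κ → E) →ₗ[k] V}
    (hΦ : ∀ y, Φ y = 0 ↔ ∃ x, y = Function.const κ x) (W : κ → Submodule k E)
    [∀ j, FiniteDimensional k (W j)] :
    finrank k ↥((pi Set.univ W).map Φ) + finrank k ↥(⨅ j, W j) = ∑ j, finrank k (W j) := by
  let incl : (∀ j, W j) →ₗ[k] κ → E := LinearMap.piMap fun j => (W j).subtype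
  let diag : ↥(⨅ j, W j) →ₗ[k] ∀ j, W j := LinearMap.pi fun j => inclusion (iInf_le W j)
  have hrange : LinearMap.range (Φ ∘ₗ incl) = (pi Set.univ W).map Φ := by
    rw [LinearMap.range_comp]
    congr 1
    ext y
    exact ⟨fun ⟨w, hw⟩ j _ => hw ▸ (w j).2, fun hy => ⟨fun j => ⟨y j, hy j trivial⟩, rfl⟩⟩
  have hker : LinearMap.ker (Φ ∘ₗ incl) = LinearMap.range diag := by
    ext w
    rw [LinearMap.mem_ker, LinearMap.comp_apply, hΦ]
    constructor
    · rintro ⟨x, hx⟩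
      have hw (j : κ) : (w j : E) = x := congrFun hx j
      exact ⟨⟨x, (mem_iInf W).2 fun j => hw j ▸ (w j).2⟩, by ext j; exact (hw j).symm⟩
    · rintro ⟨x, rfl⟩
      exact ⟨x, rfl⟩
  have hdiag : Function.Injective diag := fun x y hxy =>
    inclusion_injective (iInf_le W _) (congrFun hxy (Classical.arbitrary κ))
  rw [← hrange, ← finrank_pi_fintype, ← LinearMap.finrank_range_of_inj hdiag, ← hker,
    LinearMap.finrank_range_add_finrank_ker]

end Finrank

section Graded

variable {k ι κ E V : Type*} [Field k] [AddCommGroup E] [Module k E] [AddCommGroup V] [Module k V]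
  [DecidableEq κ] {e : ι → κ} {θ : ι → E} {Φ : (κ → E) →ₗ[k] V}

theorem span_image_single_eq_pi [Finite κ] (e : ι → κ) (θ : ι → E) (J : Set ι) :
    span k ((fun i => (Pi.single (e i) (θ i) : κ → E)) '' J) =
      pi Set.univ fun j => span k (θ '' (J ∩ e ⁻¹' {j})) := by
  rw [← iSup_map_single]
  simp only [map_span, ← span_iUnion]
  congr 1
  ext y
  simp only [Set.mem_image, Set.mem_iUnion, Set.mem_inter_iff, Set.mem_preimage,
    Set.mem_singleton_iff, LinearMap.single_apply]
  constructor
  · rintro ⟨i, hi, rfl⟩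
    exact ⟨e i, θ i, ⟨i, ⟨hi, rfl⟩, rfl⟩, rfl⟩
  · rintro ⟨_, _, ⟨i, ⟨hi, rfl⟩, rfl⟩, rfl⟩
    exact ⟨i, hi, rfl⟩

theorem SpanConnected.eq_of_single [Finite κ]
    (hconn : SpanConnected k fun i => (Pi.single (e i) (θ i) : κ → E)) (i i' : ι) : e i = e i' := by
  by_contra hne
  refine hconn (e ⁻¹' {e i}) ⟨i, rfl⟩ ⟨i', Ne.symm hne⟩ (disjoint_def.2 fun y hy hy' => ?_)
  rw [span_image_single_eq_pi, mem_pi] at hy hy'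
  ext j
  by_cases hj : j = e i
  · simpa [hj] using hy' j trivial
  · have hempty : e ⁻¹' {e i} ∩ e ⁻¹' {j} = ∅ :=
      ((Set.disjoint_singleton.2 (Ne.symm hj)).preimage e).inter_eq
    simpa only [hempty, Set.image_empty, span_empty, mem_bot, Pi.zero_apply] using hy j trivial

theorem SpanConnected.exists_sub_eq_const [Finite κ]
    (hΦ : ∀ y, Φ y = 0 ↔ ∃ x, y = Function.const κ x)
    (hconn : SpanConnected k fun i => Φ (Pi.single (e i) (θ i))) {J : Set ι} (hJ : J.Nonempty)
    (hJ' : Jᶜ.Nonempty) :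
    ∃ y z : κ → E, (∀ j, y j ∈ span k (θ '' (J ∩ e ⁻¹' {j}))) ∧
      (∀ j, z j ∈ span k (θ '' (Jᶜ ∩ e ⁻¹' {j}))) ∧
      (∃ x, y - z = Function.const κ x) ∧ ∀ x, y ≠ Function.const κ x := by
  have hspan (S : Set ι) : span k ((fun i => Φ (Pi.single (e i) (θ i))) '' S) =
      (pi Set.univ fun j => span k (θ '' (S ∩ e ⁻¹' {j}))).map Φ := by
    rw [← span_image_single_eq_pi, map_span, Set.image_image]
  have h := hconn J hJ hJ'
  simp only [hspan, disjoint_def, not_forall] at h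
  obtain ⟨_, ⟨y, hy, rfl⟩, ⟨z, hz, hzy⟩, hne⟩ := h
  refine ⟨y, z, fun j => hy j trivial, fun j => hz j trivial, (hΦ _).1 ?_,
    fun x hx => hne ((hΦ y).2 ⟨x, hx⟩)⟩
  rw [map_sub, hzy, sub_self]

theorem SpanConnected.of_graded [Finite κ]
    (hΦ : ∀ y, Φ y = 0 ↔ ∃ x, y = Function.const κ x)
    (hconn : SpanConnected k fun i => Φ (Pi.single (e i) (θ i))) : SpanConnected k θ := by
  intro J hJ hJ' hdisj
  obtain ⟨y, z, hy, hz, ⟨x, hx⟩, hconst⟩ := hconn.exists_sub_eq_const hΦ hJ hJ'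
  have hyJ (j : κ) : y j ∈ span k (θ '' J) :=
    span_mono (Set.image_mono Set.inter_subset_left) (hy j)
  have hzJ (j : κ) : z j ∈ span k (θ '' Jᶜ) :=
    span_mono (Set.image_mono Set.inter_subset_left) (hz j)
  have hsub (i j : κ) : y i - y j = z i - z j := by
    have hi : y i - z i = x := congrFun hx i
    have hj : y j - z j = x := congrFun hx j
    rw [sub_eq_sub_iff_sub_eq_sub, hi, hj]
  obtain ⟨i₀, -⟩ := hJ
  refine hconst (y (e i₀)) (funext fun j => sub_eq_zero.1 (disjoint_def.1 hdisj _ ?_ ?_))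
  · exact sub_mem (hyJ j) (hyJ (e i₀))
  · exact hsub j (e i₀) ▸ sub_mem (hzJ j) (hzJ (e i₀))

theorem SpanConnected.iInf_span_fiber_ne_bot [Finite κ]
    (hΦ : ∀ y, Φ y = 0 ↔ ∃ x, y = Function.const κ x)
    (hconn : SpanConnected k fun i => Φ (Pi.single (e i) (θ i))) (he : ∃ i i', e i ≠ e i') :
    ⨅ j, span k (θ '' (e ⁻¹' {j})) ≠ ⊥ := by
  obtain ⟨i, i', hne⟩ := he
  obtain ⟨y, z, hy, hz, ⟨x, hx⟩, hconst⟩ :=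
    hconn.exists_sub_eq_const hΦ (J := e ⁻¹' {e i}) ⟨i, rfl⟩ ⟨i', hne.symm⟩
  have hx (j : κ) : y j - z j = x := congrFun hx j
  have hy_off {j : κ} (hj : j ≠ e i) : y j = 0 := by
    have hempty : e ⁻¹' {e i} ∩ e ⁻¹' {j} = ∅ :=
      ((Set.disjoint_singleton.2 hj.symm).preimage e).inter_eq
    simpa only [hempty, Set.image_empty, span_empty, mem_bot] using hy j
  have hz_at : z (e i) = 0 := by simpa using hz (e i)
  have hx_at : y (e i) = x := by rw [← hx (e i), hz_at, sub_zero]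
  refine (Submodule.ne_bot_iff _).2
    ⟨x, (mem_iInf _).2 fun j => ?_, fun hx0 => hconst 0 (funext fun j => ?_)⟩
  · by_cases hj : j = e i
    · simpa [hj, hx_at] using hy (e i)
    · rw [← hx j, hy_off hj, zero_sub]
      exact neg_mem (span_mono (Set.image_mono Set.inter_subset_right) (hz j))
  · by_cases hj : j = e i
    · rw [hj, hx_at, hx0, Function.const_apply]
    · rw [hy_off hj, Function.const_apply]

theorem SpanConnected.finrank_add_card_le [Finite ι] [Fintype κ]
    (hΦ : ∀ y, Φ y = 0 ↔ ∃ x, y = Function.const κ x)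
    (hconn : SpanConnected k fun i => Φ (Pi.single (e i) (θ i))) (he : ∃ i i', e i ≠ e i') :
    finrank k (span k (Set.range θ)) + Fintype.card κ ≤
      finrank k (span k (Set.range fun i => Φ (Pi.single (e i) (θ i)))) + 2 := by
  let W (j : κ) : Submodule k E := span k (θ '' (e ⁻¹' {j}))
  have hfin (j : κ) : FiniteDimensional k (W j) := .span_of_finite k (Set.toFinite _)
  have hθ : span k (Set.range θ) = ⨆ j, W j := by
    rw [← span_iUnion, ← Set.image_iUnion, ← Set.preimage_iUnion, Set.iUnion_of_singleton,
      Set.preimage_univ, Set.image_univ]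
  have hη : span k (Set.range fun i => Φ (Pi.single (e i) (θ i))) = (pi Set.univ W).map Φ := by
    have := span_image_single_eq_pi (k := k) e θ Set.univ
    simp only [Set.univ_inter] at this
    rw [← this, map_span, Set.image_image, Set.image_univ]
  have hinf : ⨅ j, W j ≠ ⊥ := hconn.iInf_span_fiber_ne_bot hΦ he
  obtain ⟨i, i', hne⟩ := he
  have : Nontrivial κ := ⟨e i, e i', hne⟩
  have : FiniteDimensional k ↥(⨅ j, W j) := finiteDimensional_of_le (iInf_le W (e i))
  have hpos : 1 ≤ finrank k ↥(⨅ j, W j) := one_le_finrank_iff.2 hinf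
  have hcard : 2 ≤ Fintype.card κ := Fintype.one_lt_card
  have hsup := finrank_iSup_add_card_mul_finrank_iInf_le W
  have hmap := finrank_map_pi_add_finrank_iInf hΦ W
  have hmul : Fintype.card κ + 2 * finrank k ↥(⨅ j, W j) ≤
      Fintype.card κ * finrank k ↥(⨅ j, W j) + 2 := by nlinarith
  rw [hθ, hη]
  omega

end Graded

open IntermediateField

/-- A family of `m`-th roots of unity whose ratios are all `d`-th roots of unity only if `m ∣ d`:
the analogue of `IsPrimitiveRoot` for families up to a common factor. The ratios are avoided by
comparing `d`-th powers. -/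
structure IsPrimitiveFamily {ι M : Type*} [Monoid M] (η : ι → M) (m : ℕ) : Prop where
  pow_eq_one : ∀ i, η i ^ m = 1
  dvd_of_pow_eq : ∀ d : ℕ, (∀ i j, η i ^ d = η j ^ d) → m ∣ d

section PowCombination

variable {k L : Type*} [Field k] [Field L] [Algebra k L]

/-- The map `y ↦ ∑ j, y j * ρ ^ j`, assembling an element of `K(ρ)` from its coordinates with
respect to the first `p` powers of `ρ`; those powers are not assumed to be independent. -/
def powCombination (K : IntermediateField k L) (ρ : L) (p : ℕ) : (Fin p → K) →ₗ[k] L :=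
  (Fintype.linearCombination K fun j : Fin p => ρ ^ (j : ℕ)).restrictScalars k

theorem powCombination_apply (K : IntermediateField k L) (ρ : L) (p : ℕ) (y : Fin p → K) :
    powCombination K ρ p y = ∑ j, y j • ρ ^ (j : ℕ) := rfl

theorem powCombination_single (K : IntermediateField k L) (ρ : L) {p : ℕ} (j : Fin p) (x : K) :
    powCombination K ρ p (Pi.single j x) = x • ρ ^ (j : ℕ) :=
  Fintype.linearCombination_apply_single K (fun j : Fin p => ρ ^ (j : ℕ)) j x

theorem powCombination_injective {K : IntermediateField k L} {ρ : L} {p : ℕ}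
    (hp : (minpoly K ρ).natDegree = p) : Function.Injective (powCombination K ρ p) := by
  subst hp
  exact (linearIndependent_iff_injective_fintypeLinearCombination).1 (linearIndependent_pow ρ)

theorem powCombination_eq_zero_iff_eq_const {K : IntermediateField k L} {ρ : L} {p : ℕ}
    (hp : (minpoly K ρ).natDegree + 1 = p) (hρ : ∑ j : Fin p, ρ ^ (j : ℕ) = 0) (y : Fin p → K) :
    powCombination K ρ p y = 0 ↔ ∃ x, y = Function.const (Fin p) x := by
  have hconst (x : K) : powCombination K ρ p (Function.const _ x) = 0 := by
    simp only [powCombination_apply, Function.const_apply, ← Finset.smul_sum, hρ, smul_zero]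
  refine ⟨fun hy => ?_, fun ⟨x, hx⟩ => hx ▸ hconst x⟩
  subst hp
  let x := y (Fin.last _)
  have hsub : powCombination K ρ _ (y - Function.const _ x) = 0 := by
    rw [map_sub, hy, hconst, sub_zero]
  rw [powCombination_apply, Fin.sum_univ_castSucc] at hsub
  simp only [Pi.sub_apply, Function.const_apply, x, sub_self, zero_smul, add_zero] at hsub
  have hzero := Fintype.linearIndependent_iff.1 (linearIndependent_pow (K := K) ρ) _ hsub
  refine ⟨x, funext fun j => ?_⟩
  induction j using Fin.lastCases with
  | last => rfl
  | cast j => exact sub_eq_zero.1 (hzero j)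

variable {ξ ρ : L} {m p : ℕ} [NeZero m]

theorem mem_adjoin_simple_of_pow_eq_one (hξ : IsPrimitiveRoot ξ m) {x : L} (hx : x ^ m = 1) :
    x ∈ k⟮ξ⟯ := by
  obtain ⟨l, -, rfl⟩ := hξ.eq_pow_of_pow_eq_one hx
  exact pow_mem (mem_adjoin_simple_self k ξ) l

variable [NeZero p]

theorem exists_pow_eq_one_and_smul_pow_eq (hξ : IsPrimitiveRoot ξ m)
    (hρ : IsPrimitiveRoot (ρ ^ m) p) {x : L} (hx : x ^ (p * m) = 1) :
    ∃ (j : Fin p) (t : k⟮ξ⟯), t ^ m = 1 ∧ t • ρ ^ (j : ℕ) = x := by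
  have hρ0 : ρ ≠ 0 := fun h => hρ.ne_zero (NeZero.ne p) (by rw [h, zero_pow (NeZero.ne m)])
  obtain ⟨j, hj, hjx⟩ := hρ.eq_pow_of_pow_eq_one (ξ := x ^ m) (by rw [← pow_mul', hx])
  have ht : (x / ρ ^ j) ^ m = 1 := by
    rw [div_pow, pow_right_comm, hjx, div_self (hjx ▸ pow_ne_zero j (pow_ne_zero m hρ0))]
  exact ⟨⟨j, hj⟩, ⟨x / ρ ^ j, mem_adjoin_simple_of_pow_eq_one hξ ht⟩, Subtype.ext ht,
    div_mul_cancel₀ x (pow_ne_zero j hρ0)⟩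

theorem IsPrimitiveFamily.exists_eq_powCombination {ι : Type*} {η : ι → L}
    (hη : IsPrimitiveFamily η (p * m)) (hp : 1 < p) (hξ : IsPrimitiveRoot ξ m)
    (hρ : IsPrimitiveRoot (ρ ^ m) p) :
    ∃ (e : ι → Fin p) (t : ι → k⟮ξ⟯), (∀ i, t i ^ m = 1) ∧
      (η = fun i => powCombination k⟮ξ⟯ ρ p (Pi.single (e i) (t i))) ∧ ∃ i i', e i ≠ e i' := by
  choose e t htm ht using fun i =>
    exists_pow_eq_one_and_smul_pow_eq (k := k) hξ hρ (hη.pow_eq_one i)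
  simp only [powCombination_single]
  refine ⟨e, t, htm, funext fun i => (ht i).symm, ?_⟩
  by_contra! he
  have hpm : p * m ∣ m := hη.dvd_of_pow_eq m fun i j => by
    rw [← ht i, ← ht j, smul_pow, smul_pow, htm, htm, he i j]
  exact hp.not_ge (Nat.le_of_mul_le_mul_right
    ((Nat.le_of_dvd (NeZero.pos m) hpm).trans_eq (one_mul m).symm) (NeZero.pos m))

end PowCombination

section Cyclotomic

open Polynomial

theorem finrank_adjoin_simple_mul_natDegree_minpoly {k L : Type*} [Field k] [Field L] [Algebra k L]
    (x : L) {y : L} (hy : IsIntegral k y) :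
    finrank k k⟮x⟯ * (minpoly k⟮x⟯ y).natDegree = finrank k k⟮x, y⟯ := by
  have htower : (adjoin k⟮x⟯ {y}).restrictScalars k = k⟮x, y⟯ := adjoin_adjoin_left k {x} {y}
  rw [← adjoin.finrank hy.tower_top, finrank_mul_finrank, ← htower]
  rfl

variable {L : Type*} [Field L] [Algebra ℚ L] {ω ξ ρ : L} {m p : ℕ} [NeZero m]

theorem finrank_rat_adjoin_of_isPrimitiveRoot (hω : IsPrimitiveRoot ω m) :
    finrank ℚ ℚ⟮ω⟯ = m.totient := by
  have hm : 0 < m := NeZero.pos m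
  rw [adjoin.finrank (hω.isIntegral hm).tower_top,
    ← hω.minpoly_eq_cyclotomic_of_irreducible (cyclotomic.irreducible_rat hm), natDegree_cyclotomic]

variable [NeZero p]

theorem totient_mul_natDegree_minpoly (hω : IsPrimitiveRoot ω (p * m)) (hξ : IsPrimitiveRoot ξ m)
    (hρ : IsPrimitiveRoot (ρ ^ m) p) :
    m.totient * (minpoly ℚ⟮ξ⟯ ρ).natDegree = (p * m).totient := by
  have hpm : 0 < p * m := NeZero.pos _
  have hρpm : ρ ^ (p * m) = 1 := by rw [pow_mul', hρ.pow_eq_one]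
  have hξpm : ξ ^ (p * m) = 1 := by rw [pow_mul', hξ.pow_eq_one, one_pow]
  have hadjoin : ℚ⟮ξ, ρ⟯ = ℚ⟮ω⟯ := by
    apply le_antisymm
    · rw [adjoin_le_iff, Set.insert_subset_iff, Set.singleton_subset_iff]
      exact ⟨mem_adjoin_simple_of_pow_eq_one hω hξpm, mem_adjoin_simple_of_pow_eq_one hω hρpm⟩
    · obtain ⟨j, t, -, ht⟩ := exists_pow_eq_one_and_smul_pow_eq (k := ℚ) hξ hρ hω.pow_eq_one
      have hle : ℚ⟮ξ⟯ ≤ ℚ⟮ξ, ρ⟯ := adjoin.mono _ _ _ (by simp)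
      rw [adjoin_simple_le_iff, ← ht]
      exact mul_mem (hle t.2) (pow_mem (subset_adjoin ℚ _ (by simp)) _)
  rw [← finrank_rat_adjoin_of_isPrimitiveRoot hω, ← hadjoin,
    ← finrank_rat_adjoin_of_isPrimitiveRoot hξ]
  exact finrank_adjoin_simple_mul_natDegree_minpoly ξ (.of_pow hpm (hρpm ▸ isIntegral_one))

theorem natDegree_minpoly_of_dvd (hp : p.Prime) (hpm : p ∣ m) (hω : IsPrimitiveRoot ω (p * m)) :
    (minpoly ℚ⟮ω ^ p⟯ ω).natDegree = p := by
  have hpm0 : 0 < p * m := NeZero.pos _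
  have h := totient_mul_natDegree_minpoly hω (hω.pow hpm0 rfl) (hω.pow hpm0 (mul_comm p m))
  rw [Nat.totient_mul_of_prime_of_dvd hp hpm, mul_comm] at h
  exact Nat.eq_of_mul_eq_mul_right (Nat.totient_pos.2 (NeZero.pos m)) h

theorem natDegree_minpoly_of_coprime (hpm : p.Coprime m) (hξ : IsPrimitiveRoot ξ m)
    (hρ : IsPrimitiveRoot ρ p) : (minpoly ℚ⟮ξ⟯ ρ).natDegree = p.totient := by
  have hω : IsPrimitiveRoot (ρ * ξ) (p * m) := by
    rw [hρ.eq_orderOf, hξ.eq_orderOf] at hpm ⊢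
    rw [← (Commute.all ρ ξ).orderOf_mul_eq_mul_orderOf_of_coprime hpm]
    exact IsPrimitiveRoot.orderOf _
  have h := totient_mul_natDegree_minpoly hω hξ (hρ.pow_of_coprime m hpm.symm)
  rw [Nat.totient_mul hpm, mul_comm] at h
  exact Nat.eq_of_mul_eq_mul_right (Nat.totient_pos.2 (NeZero.pos m)) h

theorem powCombination_eq_zero_iff_of_coprime (hp : p.Prime) (hpm : p.Coprime m)
    (hξ : IsPrimitiveRoot ξ m) (hρ : IsPrimitiveRoot ρ p) (y : Fin p → ℚ⟮ξ⟯) :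
    powCombination ℚ⟮ξ⟯ ρ p y = 0 ↔ ∃ x, y = Function.const (Fin p) x := by
  refine powCombination_eq_zero_iff_eq_const ?_ ?_ y
  · rw [natDegree_minpoly_of_coprime hpm hξ hρ, Nat.totient_prime hp, Nat.sub_add_cancel hp.one_le]
  · rw [Fin.sum_univ_eq_sum_range (ρ ^ ·), hρ.geom_sum_eq_zero hp.one_lt]

end Cyclotomic

section RootsOfUnity

variable {ι : Type*}

theorem squarefree_of_spanConnected {L : Type*} [Field L] [Algebra ℚ L] {η : ι → L} {ω : L}
    {m : ℕ} (hm : m ≠ 0) (hω : IsPrimitiveRoot ω m) (hη : IsPrimitiveFamily η m)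
    (hconn : SpanConnected ℚ η) : Squarefree m := by
  rw [Nat.squarefree_iff_prime_squarefree]
  rintro p hp ⟨m, rfl⟩
  rw [mul_assoc] at hm hω hη
  have : NeZero p := ⟨left_ne_zero_of_mul hm⟩
  have : NeZero (p * m) := ⟨right_ne_zero_of_mul hm⟩
  have hpos := Nat.pos_of_ne_zero hm
  obtain ⟨e, t, -, rfl, i, i', hne⟩ := hη.exists_eq_powCombination (k := ℚ) hp.one_lt
    (hω.pow hpos rfl) (hω.pow hpos (mul_comm _ _))
  have hinj := powCombination_injective (natDegree_minpoly_of_dvd hp (dvd_mul_right p m) hω)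
  exact hne ((hconn.of_injective hinj).eq_of_single i i')

theorem exists_isPrimitiveFamily_finrank_add_le [Finite ι] {L : Type*} [Field L] [Algebra ℚ L]
    {η : ι → L} {ξ ρ : L} {m p : ℕ} (hp : p.Prime) (hpm : p.Coprime m) (hm : m ≠ 0)
    (hξ : IsPrimitiveRoot ξ m) (hρ : IsPrimitiveRoot ρ p) (hη : IsPrimitiveFamily η (p * m))
    (hconn : SpanConnected ℚ η) :
    ∃ t : ι → ℚ⟮ξ⟯, IsPrimitiveFamily t m ∧ SpanConnected ℚ t ∧
      finrank ℚ (span ℚ (Set.range t)) + p ≤ finrank ℚ (span ℚ (Set.range η)) + 2 := by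
  have : NeZero p := ⟨hp.ne_zero⟩
  have : NeZero m := ⟨hm⟩
  obtain ⟨e, t, htm, rfl, he⟩ := hη.exists_eq_powCombination (k := ℚ) hp.one_lt hξ
    (hρ.pow_of_coprime m hpm.symm)
  have hΦ := powCombination_eq_zero_iff_of_coprime hp hpm hξ hρ
  refine ⟨t, ⟨htm, fun d hd => ?_⟩, .of_graded hΦ hconn, ?_⟩
  · have hρd (j : Fin p) : (ρ ^ (j : ℕ)) ^ (p * d) = 1 := by
      rw [pow_right_comm, pow_mul, hρ.pow_eq_one, one_pow, one_pow]
    refine Nat.dvd_of_mul_dvd_mul_left hp.pos (hη.dvd_of_pow_eq (p * d) fun i j => ?_)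
    simp only [powCombination_single, smul_pow, hρd]
    rw [pow_mul', pow_mul', hd i j]
  · simpa only [Fintype.card_fin] using SpanConnected.finrank_add_card_le hΦ hconn he

theorem conwayJonesPsi_one : conwayJonesPsi 1 = 2 := by simp [conwayJonesPsi]

theorem conwayJonesPsi_prime_mul {p m : ℕ} (hp : p.Prime) (hpm : p.Coprime m) :
    conwayJonesPsi (p * m) = (p - 2) + conwayJonesPsi m := by
  have hdisj : Disjoint {p} m.primeFactors := hp.primeFactors ▸ hpm.disjoint_primeFactors
  rw [conwayJonesPsi, conwayJonesPsi, hpm.primeFactors_mul, hp.primeFactors,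
    Finset.sum_union hdisj, Finset.sum_singleton]
  ring

theorem conwayJonesPsi_le_finrank_add_one [Finite ι] [Nonempty ι] {m : ℕ} (hsq : Squarefree m)
    {L : Type*} [Field L] [Algebra ℚ L] {η : ι → L} {ω : L} (hω : IsPrimitiveRoot ω m)
    (hη : IsPrimitiveFamily η m) (hconn : SpanConnected ℚ η) :
    conwayJonesPsi m ≤ finrank ℚ (span ℚ (Set.range η)) + 1 := by
  induction m using induction_on_primes generalizing L with
  | zero => exact absurd hsq not_squarefree_zero
  | one =>
    have hne : span ℚ (Set.range η) ≠ ⊥ := fun h => by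
      obtain ⟨i⟩ := ‹Nonempty ι›
      have hi : η i = 0 := span_eq_bot.1 h _ (Set.mem_range_self i)
      simpa [hi] using hη.pow_eq_one i
    have : FiniteDimensional ℚ (span ℚ (Set.range η)) := .span_of_finite ℚ (Set.finite_range η)
    have hpos := one_le_finrank_iff.2 hne
    rw [conwayJonesPsi_one]
    omega
  | prime_mul p m hp ih =>
    have hpm : p.Coprime m := Nat.coprime_of_squarefree_mul hsq
    have hm : m ≠ 0 := hsq.of_mul_right.ne_zero
    have hpos : 0 < p * m := Nat.mul_pos hp.pos (Nat.pos_of_ne_zero hm)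
    have hξ : IsPrimitiveRoot (ω ^ p) m := hω.pow hpos rfl
    obtain ⟨t, ht, hconn_t, hdim⟩ := exists_isPrimitiveFamily_finrank_add_le hp hpm hm hξ
      (hω.pow hpos (mul_comm p m)) hη hconn
    have hgen : IsPrimitiveRoot (AdjoinSimple.gen ℚ (ω ^ p)) m :=
      .of_map_of_injective (f := algebraMap ℚ⟮ω ^ p⟯ L) hξ (algebraMap ℚ⟮ω ^ p⟯ L).injective
    -- Otherwise `ih` is read with `DivisionRing.toRatAlgebra`, not defeq to the algebra used above.
    let : Algebra ℚ ℚ⟮ω ^ p⟯ := IntermediateField.algebra' _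
    have hrec := ih hsq.of_mul_right hgen ht hconn_t
    rw [conwayJonesPsi_prime_mul hp hpm]
    omega

end RootsOfUnity

section Torus

theorem eq_one_of_prod_zpow_eq_one {ι G : Type*} [Fintype ι] [CommGroup G] {w : ι → G}
    {s : Set (ι → ℤ)} (hs : AddSubgroup.closure s = ⊤) (hw : ∀ l ∈ s, ∏ i, w i ^ l i = 1) :
    w = 1 := by
  classical
  have hall (l : ι → ℤ) : ∏ i, w i ^ l i = 1 := by
    induction hs ▸ AddSubgroup.mem_top l using AddSubgroup.closure_induction with
    | mem l hl => exact hw l hl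
    | zero => simp only [Pi.zero_apply, zpow_zero, Finset.prod_const_one]
    | add l l' _ _ hl hl' => simp only [Pi.add_apply, zpow_add, Finset.prod_mul_distrib, hl, hl',
        one_mul]
    | neg l _ hl => simp only [Pi.neg_apply, zpow_neg, Finset.prod_inv_distrib, hl, inv_one]
  ext i
  simpa [Pi.single_apply, Finset.prod_ite_eq'] using hall (Pi.single i 1)

theorem isPrimitiveFamily_torusMonomial {n : ℕ} {ι : Type*} (ζ : Fin n → MuInf)
    {α : ι → Fin n → ℤ} (hgen : AddSubgroup.closure {β | ∃ i j, β = α i - α j} = ⊤) :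
    IsPrimitiveFamily (fun i => torusMonomial (fun j => (ζ j : QBarˣ)) (α i)) (orderOf ζ) := by
  have hpow (d : ℕ) (l : Fin n → ℤ) : torusMonomial (fun j => (ζ j : QBarˣ)) l ^ d =
      ((∏ j, (ζ ^ d) j ^ l j : MuInf) : QBarˣ) := by
    rw [torusMonomial, ← Units.val_pow_eq_pow_val, ← Finset.prod_pow, Subgroup.val_finsetProd]
    simp only [Pi.pow_apply, Subgroup.coe_zpow, ← zpow_natCast, zpow_comm]
  refine ⟨fun i => ?_, fun d hd => ?_⟩
  · rw [hpow, pow_orderOf_eq_one]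
    simp
  · refine orderOf_dvd_of_pow_eq_one (eq_one_of_prod_zpow_eq_one hgen ?_)
    rintro _ ⟨i, j, rfl⟩
    have hij := hd i j
    rw [hpow, hpow, Units.val_inj, Subtype.coe_inj] at hij
    simp only [Pi.sub_apply, zpow_sub, Finset.prod_mul_distrib, Finset.prod_inv_distrib, hij,
      mul_inv_cancel]

theorem orderOf_pos_of_torsion {ι G : Type*} [Finite ι] [CommGroup G]
    (ζ : ι → CommGroup.torsion G) : 0 < orderOf ζ :=
  (IsOfFinOrder.pi fun i => Submonoid.isOfFinOrder_coe.1 (ζ i).2).orderOf_pos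

theorem nontrivial_of_closure_sub_eq_top {ι A : Type*} [AddGroup A] [Nontrivial A] {α : ι → A}
    (hgen : AddSubgroup.closure {β | ∃ i j, β = α i - α j} = ⊤) : Nontrivial ι := by
  by_contra h
  have : Subsingleton ι := not_nontrivial_iff_subsingleton.1 h
  refine bot_ne_top ((AddSubgroup.closure_eq_bot_iff.2 ?_).symm.trans hgen)
  rintro _ ⟨i, j, rfl⟩
  rw [Subsingleton.elim i j, sub_self, Set.mem_singleton_iff]

theorem MvLaurent.eval_sum_single {n : ℕ} {ι : Type*} [Fintype ι] (z : Fin n → QBarˣ) (a : ι → ℤ)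
    (α : ι → Fin n → ℤ) :
    MvLaurent.eval z (∑ i, AddMonoidAlgebra.single (α i) (a i)) =
      ∑ i, (a i : QBar) * torusMonomial z (α i) := by
  classical
  rw [MvLaurent.eval, AddMonoidAlgebra.coeff_sum,
    ← Finsupp.sum_finsetSum_index (by simp) (by intros; push_cast; ring)]
  refine Finset.sum_congr rfl fun i _ => ?_
  rw [AddMonoidAlgebra.coeff_single]
  exact Finsupp.sum_single_index (by simp)

theorem NoProperSubsumVanishes.ne_zero {ι : Type*} [Fintype ι] [Nontrivial ι] {v : ι → QBar}
    (hv : NoProperSubsumVanishes v) (i : ι) : v i ≠ 0 := by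
  simpa only [Finset.sum_singleton] using
    hv {i} (Finset.singleton_nonempty i) (Finset.singleton_ne_univ i)

end Torus

theorem mainTheorem5 (n : ℕ) (hn : 1 ≤ n)
    (ζ : Fin n → MuInf) (m : ℕ) (hm : orderOf ζ = m)
    (N : ℕ) (a : Fin N → ℤ) (α : Fin N → Fin n → ℤ)
    (F : MvLaurent n) (hF : F = ∑ i, AddMonoidAlgebra.single (α i) (a i))
    (hzero : MvLaurent.eval (fun j => (ζ j : QBarˣ)) F = 0)
    (hmin : NoProperSubsumVanishes
      fun i : Fin N => (a i : QBar) * torusMonomial (fun j => (ζ j : QBarˣ)) (α i))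
    (hgen : AddSubgroup.closure
      {β : Fin n → ℤ | ∃ i j : Fin N, β = α i - α j} = ⊤) :
    Squarefree m ∧ conwayJonesPsi m ≤ (N : ℤ) := by
  rw [hF, MvLaurent.eval_sum_single] at hzero
  have : Nonempty (Fin n) := ⟨⟨0, hn⟩⟩
  have : Nontrivial (Fin N) := nontrivial_of_closure_sub_eq_top hgen
  have hm0 : m ≠ 0 := hm ▸ (orderOf_pos_of_torsion ζ).ne'
  have : NeZero (m : QBar) := ⟨Nat.cast_ne_zero.2 hm0⟩
  obtain ⟨ω, hω⟩ := HasEnoughRootsOfUnity.exists_primitiveRoot QBar m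
  have hη := hm ▸ isPrimitiveFamily_torusMonomial ζ hgen
  set η : Fin N → QBar := fun i => torusMonomial (fun j => (ζ j : QBarˣ)) (α i)
  have hsmul (i : Fin N) : (a i : QBar) * η i = (a i : ℚ) • η i := by
    rw [Algebra.smul_def, map_intCast]
  have hne (i : Fin N) : (a i : ℚ) ≠ 0 := fun h => hmin.ne_zero i (by simp [Int.cast_eq_zero.1 h])
  change ∑ i, (a i : QBar) * η i = 0 at hzero
  change NoProperSubsumVanishes fun i => (a i : QBar) * η i at hmin
  simp only [hsmul] at hzero hmin
  have hconn : SpanConnected ℚ η := spanConnected_of_sum_smul_eq_zero hzero hmin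
  have hlt := finrank_span_range_lt_card hzero (hne (Classical.arbitrary _))
  have hsq : Squarefree m := squarefree_of_spanConnected hm0 hω hη hconn
  have hle := conwayJonesPsi_le_finrank_add_one hsq hω hη hconn
  rw [Fintype.card_fin] at hlt
  exact ⟨hsq, by omega⟩
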